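/- Let $S$ be a non-compact surface, that is, a non-compact topological $2$-manifold without boundary (connected or not), with a metric $d$ inducing its topology. Let $f:S\to S$ be a topologically Anosov (TA) homeomorphism, meaning: (i) (topological expansivity) there is a continuous $\epsilon:S\to(0,\infty)$ such that for all $x\neq y$ in $S$ there is $k\in\mathbb Z$ with $d(f^k(x),f^k(y))>\epsilon(f^k(x))$; (ii) (topological shadowing) for every continuous $\epsilon:S\to(0,\infty)$ there is a continuous $\delta:S\to(0,\infty)$ such that every sequence $(x_n)_{n\in\mathbb Z}$ in $S$ with $d(f(x_n),x_{n+1})<\delta(f(x_n))$ for all $n\in\mathbb Z$ admits a point $x\in S$ with $d(x_n,f^n(x))<\epsilon(x_n)$ for all $n\in\mathbb Z$. A basic set of $f$ is a member of a spectral decomposition of $f$, i.e. of a family of non-empty, pairwise disjoint, closed, $f$-invariant sets on each of which $f$ is topologically transitive, and whose union is the non-wandering set $\Omega(f)$. A set $\Lambda$ is attracting if it has an open neighborhood $U$ with $\overline{f(U)}\subset U$ and $\bigcap_{n\ge 0}f^n(U)=\Lambda$; it is repelling if it is attracting for $f^{-1}$. A basic set $\Lambda$ is of saddle type if there are points $x,y\notin\Omega(f)$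 such that $\emptyset\neq\omega(x)\subset\Lambda$ and $\emptyset\neq\alpha(y)\subset\Lambda$. Then $f$ has at least one basic set that is attracting or repelling. In particular, not every basic set of $f$ is of saddle type. -/

import Mathlib

open Set Filter Topology

namespace TopAnosov

section Metric

variable {S : Type*} [MetricSpace S]

/-- `(x n)_{n ∈ ℤ}` is a `δ`-pseudo-orbit of `f`, for a function `δ : S → ℝ`. -/
def IsPseudoOrbit (f : S ≃ₜ S) (δ : S → ℝ) (x : ℤ → S) : Prop :=
  ∀ n : ℤ, dist (f (x n)) (x (n + 1)) < δ (f (x n))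

/-- `(x n)_{n ∈ ℤ}` is `ε`-shadowed by the orbit of some point. -/
def IsShadowed (f : S ≃ₜ S) (ε : S → ℝ) (x : ℤ → S) : Prop :=
  ∃ p : S, ∀ n : ℤ, dist (x n) ((f ^ n) p) < ε (x n)

/-- Topological expansivity. -/
def IsTopExpansive (f : S ≃ₜ S) : Prop :=
  ∃ ε : S → ℝ, Continuous ε ∧ (∀ x, 0 < ε x) ∧
    ∀ x y : S, x ≠ y → ∃ k : ℤ, ε ((f ^ k) x) < dist ((f ^ k) x) ((f ^ k) y)

/-- The topological shadowing property. -/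
def HasTopShadowing (f : S ≃ₜ S) : Prop :=
  ∀ ε : S → ℝ, Continuous ε → (∀ x, 0 < ε x) →
    ∃ δ : S → ℝ, Continuous δ ∧ (∀ x, 0 < δ x) ∧
      ∀ x : ℤ → S, IsPseudoOrbit f δ x → IsShadowed f ε x

/-- Topologically Anosov homeomorphisms. -/
def IsTA (f : S ≃ₜ S) : Prop :=
  IsTopExpansive f ∧ HasTopShadowing f

end Metric

section Topological

variable {S : Type*} [TopologicalSpace S]

/-- The nonwandering set `Ω(f)`. -/
def nonwanderingSet (f : S ≃ₜ S) : Set S :=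
  {x | ∀ U : Set S, IsOpen U → x ∈ U → ∃ n : ℕ, 1 ≤ n ∧ ((f ^ n) '' U ∩ U).Nonempty}

/-- `f` is topologically transitive on the set `L`: for any two nonempty relatively open subsets
`L ∩ U` and `L ∩ V` of `L`, some forward image of the first one meets the second one. -/
def IsTransitiveOn (f : S ≃ₜ S) (L : Set S) : Prop :=
  ∀ U V : Set S, IsOpen U → IsOpen V → (L ∩ U).Nonempty → (L ∩ V).Nonempty →
    ∃ n : ℕ, ((f ^ n) '' (L ∩ U) ∩ (L ∩ V)).Nonempty

/-- `B` is a spectral decomposition of `f`: a family of nonempty, pairwise disjoint, closed,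
invariant sets on each of which `f` is topologically transitive, and whose union is `Ω(f)`. -/
structure IsSpectralDecomposition (f : S ≃ₜ S) (B : Set (Set S)) : Prop where
  sUnion_eq : ⋃₀ B = nonwanderingSet f
  pairwiseDisjoint : B.PairwiseDisjoint id
  nonempty : ∀ L ∈ B, L.Nonempty
  isClosed : ∀ L ∈ B, IsClosed L
  invariant : ∀ L ∈ B, f '' L = L
  transitive : ∀ L ∈ B, IsTransitiveOn f L

/-- A basic set of `f` is a member of a spectral decomposition of `f`. -/
def IsBasicSet (f : S ≃ₜ S) (L : Set S) : Prop :=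
  ∃ B : Set (Set S), IsSpectralDecomposition f B ∧ L ∈ B

/-- `L` is attracting: it has an open neighborhood `U` such that the closure of `f(U)` is
contained in `U` and the intersection of all the forward images of `U` is `L`. -/
def IsAttracting (f : S ≃ₜ S) (L : Set S) : Prop :=
  ∃ U : Set S, IsOpen U ∧ L ⊆ U ∧ closure (f '' U) ⊆ U ∧ ⋂ n : ℕ, (f ^ n) '' U = L

/-- `L` is repelling for `f` if it is attracting for the inverse of `f`. -/
def IsRepelling (f : S ≃ₜ S) (L : Set S) : Prop :=
  IsAttracting f⁻¹ L

/-- The `ω`-limit set of the point `x` under `f`. -/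
def omegaSet (f : S ≃ₜ S) (x : S) : Set S :=
  omegaLimit atTop (fun (k : ℤ) (y : S) => (f ^ k) y) {x}

/-- The `α`-limit set of the point `x` under `f`. -/
def alphaSet (f : S ≃ₜ S) (x : S) : Set S :=
  omegaLimit atBot (fun (k : ℤ) (y : S) => (f ^ k) y) {x}

/-- `L` is of saddle type: there are a wandering point whose (nonempty) `ω`-limit set is contained
in `L`, and a wandering point whose (nonempty) `α`-limit set is contained in `L`. Nonemptiness
excludes half-orbits that escape to infinity. -/
def IsSaddle (f : S ≃ₜ S) (L : Set S) : Prop :=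
  (∃ x, x ∉ nonwanderingSet f ∧ (omegaSet f x).Nonempty ∧ omegaSet f x ⊆ L) ∧
    ∃ y, y ∉ nonwanderingSet f ∧ (alphaSet f y).Nonempty ∧ alphaSet f y ⊆ L

end Topological

end TopAnosov

open Set Filter Topology

namespace TopAnosov

/-! ### Neighborhoods of the diagonal in place of scale functions. -/

section Entourages

/-! Expansivity and shadowing are read through neighborhoods of the diagonal. Shadowing makes
periodic points dense in Ω(f), and a single scale decides whether two points of Ω(f) reach each
other by arbitrarily fine chains (`IsDiagTA.exists_leads_of_chain`). The chain classes therefore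
form a spectral decomposition, and one of them is shown to be attracting or repelling.

If some backward orbit escapes to infinity, the scale can shrink so fast along it that a
pseudo-orbit with this past is shadowed only by the orbit itself. Points near the forward orbit then
keep close to it (`IsDiagTA.exists_forward_close`). As no point is isolated, this forward orbit has
a cluster point; expansivity makes the class of a nearby periodic point attracting. If a forward
orbit escapes, the same argument for f⁻¹ gives a repelling class.

If nothing escapes, an endless sequence of chains, each leaving the class it starts from, would be
shadowed by an orbit with a forward cluster point. Its return closes up a chain between two
consecutive classes, which is absurd. Hence some class is terminal at a fixed scale, and the points
reachable from it form a trapping region (`IsDiagTA.isAttracting_chainClass`).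

An attracting set contains every point with a backward cluster point in it, so an attracting basic
set receives no α-limit of a wandering point; dually for repelling ones. Neither is of saddle type.
-/

theorem mem_nhdsSet_diagonal {S : Type*} [TopologicalSpace S] {N : Set (S × S)} :
    N ∈ 𝓝ˢ (diagonal S) ↔ ∀ x, N ∈ 𝓝 (x, x) := by
  rw [mem_nhdsSet_iff_forall]
  exact ⟨fun h x => h _ rfl, fun h ⟨x, y⟩ hxy => by obtain rfl : x = y := hxy; exact h x⟩

theorem refl_mem_of_mem_nhdsSet_diagonal {S : Type*} [TopologicalSpace S] {N : Set (S × S)}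
    (hN : N ∈ 𝓝ˢ (diagonal S)) (x : S) : (x, x) ∈ N :=
  mem_of_mem_nhds (mem_nhdsSet_diagonal.1 hN x)

theorem swap_mem_nhdsSet_diagonal {S : Type*} [TopologicalSpace S] {N : Set (S × S)}
    (hN : N ∈ 𝓝ˢ (diagonal S)) : Prod.swap ⁻¹' N ∈ 𝓝ˢ (diagonal S) := by
  rw [mem_nhdsSet_diagonal] at *
  exact fun x => continuous_swap.continuousAt.preimage_mem_nhds (hN x)

theorem preimage_map_mem_nhdsSet_diagonal {S : Type*} [TopologicalSpace S] {N : Set (S × S)}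
    {g : S → S} (hg : Continuous g) (hN : N ∈ 𝓝ˢ (diagonal S)) :
    {z : S × S | (g z.1, g z.2) ∈ N} ∈ 𝓝ˢ (diagonal S) := by
  rw [mem_nhdsSet_diagonal] at *
  exact fun x => (hg.prodMap hg).continuousAt.preimage_mem_nhds (hN (g x))

theorem setOf_dist_lt_mem_nhdsSet_diagonal {S : Type*} [MetricSpace S] {ε : S → ℝ}
    (hε : Continuous ε) (hpos : ∀ x, 0 < ε x) :
    {z : S × S | dist z.1 z.2 < ε z.1} ∈ 𝓝ˢ (diagonal S) := by
  refine (IsOpen.mem_nhdsSet (isOpen_lt continuous_dist (hε.comp continuous_fst))).2 ?_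
  rintro ⟨x, y⟩ hxy
  obtain rfl : x = y := hxy
  simpa using hpos x

/-- Every neighborhood of the diagonal contains the one given by a positive `1`-Lipschitz
function. -/
theorem exists_lipschitz_of_mem_nhdsSet_diagonal {S : Type*} [MetricSpace S] {N : Set (S × S)}
    (hN : N ∈ 𝓝ˢ (diagonal S)) :
    ∃ ρ : S → ℝ, LipschitzWith 1 ρ ∧ (∀ x, 0 < ρ x) ∧
      ∀ x y, dist x y < ρ x → (x, y) ∈ N := by
  obtain ⟨O, hO, hdO, hON⟩ := mem_nhdsSet_iff_exists.1 hN
  -- `Metric.infDist` to the empty set is `0`, hence not positive.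
  rcases Set.eq_empty_or_nonempty Oᶜ with h | h
  · refine ⟨fun _ => 1, LipschitzWith.const' 1, fun _ => one_pos, fun x y _ => hON ?_⟩
    rw [compl_empty_iff] at h
    simp [h]
  · refine ⟨fun x => Metric.infDist (x, x) Oᶜ, ?_, fun x => ?_, fun x y hxy => hON ?_⟩
    · have := (Metric.lipschitz_infDist_pt Oᶜ).comp
        ((LipschitzWith.id (α := S)).prodMk LipschitzWith.id)
      simpa [Function.comp_def] using this
    · exact (hO.isClosed_compl.notMem_iff_infDist_pos h).1 (fun hx => hx (hdO rfl))
    · by_contra hc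
      have := Metric.infDist_le_dist_of_mem (x := (x, x)) (show (x, y) ∈ Oᶜ from hc)
      rw [Prod.dist_eq] at this
      simp only [dist_self] at this
      rw [max_eq_right dist_nonneg] at this
      linarith

theorem exists_symm_comp_nhdsSet_diagonal {S : Type*} [MetricSpace S] {N : Set (S × S)}
    (hN : N ∈ 𝓝ˢ (diagonal S)) :
    ∃ M ∈ 𝓝ˢ (diagonal S), IsOpen M ∧ M ⊆ N ∧ (∀ x y, (x, y) ∈ M → (y, x) ∈ M) ∧
      ∀ x y z, (x, y) ∈ M → (y, z) ∈ M → (x, z) ∈ N := by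
  -- With ρ/4 two steps fit: ρ y ≤ ρ x + ρ x / 4, so the total is below ρ x.
  obtain ⟨ρ, hρ, hpos, hsub⟩ := exists_lipschitz_of_mem_nhdsSet_diagonal hN
  have hc : Continuous fun x => ρ x / 4 := hρ.continuous.div_const 4
  have hmem := setOf_dist_lt_mem_nhdsSet_diagonal hc (fun x => by have := hpos x; positivity)
  have hop : IsOpen {z : S × S | dist z.1 z.2 < ρ z.1 / 4} :=
    isOpen_lt continuous_dist (hc.comp continuous_fst)
  have hle : ∀ x y, ρ x ≤ ρ y + dist x y := fun x y => by
    have := hρ.dist_le_mul x y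
    rw [Real.dist_eq] at this
    have := (abs_le.1 this).2
    simp at this
    linarith
  refine ⟨{z | dist z.1 z.2 < ρ z.1 / 4} ∩ Prod.swap ⁻¹' {z | dist z.1 z.2 < ρ z.1 / 4},
    inter_mem hmem (swap_mem_nhdsSet_diagonal hmem), hop.inter (hop.preimage continuous_swap),
    ?_, fun x y h => ⟨h.2, h.1⟩, ?_⟩
  · rintro ⟨x, y⟩ ⟨h, -⟩
    have := hpos x
    simp only [mem_ofPred_eq] at h
    exact hsub _ _ (by linarith)
  · rintro x y z ⟨h, -⟩ ⟨h', -⟩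
    simp only [mem_ofPred_eq] at h h'
    have := hpos x
    have := hle y x
    rw [dist_comm y x] at this
    have := dist_triangle x y z
    exact hsub _ _ (by linarith)

/-- In a locally compact metric space some neighborhood of the diagonal has all its slices
contained in compact sets. -/
theorem exists_compact_slices {S : Type*} [MetricSpace S] [LocallyCompactSpace S] :
    ∃ N ∈ 𝓝ˢ (diagonal S), ∀ x, ∃ K, IsCompact K ∧ ∀ y, (x, y) ∈ N → y ∈ K := by
  -- The admissible radii at each point form a convex set and one radius works locally, so a
  -- partition of unity yields a continuous choice.
  obtain ⟨ε, hε⟩ := exists_continuous_forall_mem_convex_of_local_const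
    (t := fun x : S => {r : ℝ | 0 < r ∧ IsCompact (Metric.closedBall x r)}) (fun x => by
      refine OrdConnected.convex ⟨fun a ha b hb c hc => ⟨ha.1.trans_le hc.1, ?_⟩⟩
      exact hb.2.of_isClosed_subset Metric.isClosed_closedBall
        (Metric.closedBall_subset_closedBall hc.2))
    (fun x => by
      obtain ⟨r, hr, hK⟩ := Metric.exists_isCompact_closedBall x
      refine ⟨r / 2, ?_⟩
      filter_upwards [Metric.ball_mem_nhds x (half_pos hr)] with y hy
      refine ⟨half_pos hr, hK.of_isClosed_subset Metric.isClosed_closedBall ?_⟩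
      refine Metric.closedBall_subset_closedBall' ?_
      rw [Metric.mem_ball] at hy
      linarith)
  refine ⟨_, setOf_dist_lt_mem_nhdsSet_diagonal ε.continuous fun x => (hε x).1, fun x =>
    ⟨_, (hε x).2, fun y hy => ?_⟩⟩
  simp only [mem_ofPred_eq] at hy
  rw [Metric.mem_closedBall, dist_comm]
  exact hy.le

/-- A neighborhood of the diagonal may be made arbitrarily thin along a sequence without
cluster points. -/
theorem thin_mem_nhdsSet_diagonal {S : Type*} [TopologicalSpace S] [T1Space S] {u : ℕ → S}
    (hu : ∀ x, ¬ MapClusterPt x atTop u) {W : ℕ → Set S} (hW : ∀ n, W n ∈ 𝓝 (u n)) :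
    {z : S × S | ∀ n, z.1 = u n → z.2 ∈ W n} ∈ 𝓝ˢ (diagonal S) := by
  rw [mem_nhdsSet_diagonal]
  intro x
  have hx := hu x
  rw [mapClusterPt_iff_frequently] at hx
  push Not at hx
  -- Near `x` only finitely many indices impose a condition.
  obtain ⟨s, hs, hs'⟩ := hx
  obtain ⟨m, hm⟩ := eventually_atTop.1 hs'
  have h1 : ∀ᶠ z : S × S in 𝓝 (x, x), z.1 ∈ s := continuousAt_fst.preimage_mem_nhds hs
  have h2 : ∀ᶠ z : S × S in 𝓝 (x, x), ∀ n < m, z.1 = u n → z.2 ∈ W n := by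
    rw [show (∀ᶠ z : S × S in 𝓝 (x, x), ∀ n < m, z.1 = u n → z.2 ∈ W n) ↔
      ∀ n < m, ∀ᶠ z : S × S in 𝓝 (x, x), z.1 = u n → z.2 ∈ W n from
      eventually_all_finite (finite_lt_nat m)]
    intro n _
    by_cases hn : x = u n
    · filter_upwards [continuousAt_snd.preimage_mem_nhds (hn ▸ hW n : W n ∈ 𝓝 x)] with z hz _
      exact hz
    · filter_upwards [continuousAt_fst.preimage_mem_nhds
        (isOpen_compl_singleton.mem_nhds hn : {u n}ᶜ ∈ 𝓝 x)] with z hz h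
      exact (hz h).elim
  filter_upwards [h1, h2] with z hz1 hz2 n hn
  by_cases hnm : n < m
  · exact hz2 n hnm hn
  · exact (hm n (not_lt.1 hnm) (hn ▸ hz1)).elim

theorem closed_mem_nhdsSet_diagonal {S : Type*} [TopologicalSpace S] {A U : Set S}
    (hA : IsClosed A) (hU : ∀ x ∈ A, U ∈ 𝓝 x) :
    {z : S × S | z.1 ∈ A → z.2 ∈ U} ∈ 𝓝ˢ (diagonal S) := by
  rw [mem_nhdsSet_diagonal]
  intro y
  by_cases hy : y ∈ A
  · filter_upwards [continuousAt_snd.preimage_mem_nhds (hU y hy)] with z hz _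
    exact hz
  · filter_upwards [continuousAt_fst.preimage_mem_nhds (hA.isOpen_compl.mem_nhds hy)] with z hz h
    exact (hz h).elim

theorem point_mem_nhdsSet_diagonal {S : Type*} [TopologicalSpace S] [T1Space S] {x : S}
    {U : Set S} (hU : U ∈ 𝓝 x) : {z : S × S | z.1 = x → z.2 ∈ U} ∈ 𝓝ˢ (diagonal S) :=
  closed_mem_nhdsSet_diagonal isClosed_singleton fun y hy => by
    obtain rfl : y = x := hy
    exact hU

/-- Near a point all pairs belong to a given neighborhood of the diagonal. -/
theorem exists_open_prod_subset {S : Type*} [TopologicalSpace S] {N : Set (S × S)}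
    (hN : N ∈ 𝓝ˢ (diagonal S)) (x : S) :
    ∃ U, IsOpen U ∧ x ∈ U ∧ ∀ a ∈ U, ∀ b ∈ U, (a, b) ∈ N := by
  have h := mem_nhdsSet_diagonal.1 hN x
  rw [mem_nhds_prod_iff'] at h
  obtain ⟨u, v, hu, hxu, hv, hxv, h⟩ := h
  exact ⟨u ∩ v, hu.inter hv, ⟨hxu, hxv⟩, fun a ha b hb => h ⟨ha.1, hb.2⟩⟩

theorem exists_open_mem_nhdsSet_diagonal {S : Type*} [TopologicalSpace S] {N : Set (S × S)}
    (hN : N ∈ 𝓝ˢ (diagonal S)) : ∃ M ∈ 𝓝ˢ (diagonal S), IsOpen M ∧ M ⊆ N := by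
  obtain ⟨O, hO, hdO, hON⟩ := mem_nhdsSet_iff_exists.1 hN
  exact ⟨O, hO.mem_nhdsSet.2 hdO, hO, hON⟩

end Entourages

end TopAnosov

namespace TopAnosov

/-! ### Chains, cluster points and periodic points. -/

section Chains

variable {S : Type*} [TopologicalSpace S]

/-- Topologically Anosov homeomorphisms, in terms of neighborhoods of the diagonal. -/
def IsDiagTA (f : S ≃ₜ S) : Prop :=
  (∃ N ∈ 𝓝ˢ (diagonal S), ∀ x y, (∀ k : ℤ, ((f ^ k) x, (f ^ k) y) ∈ N) → x = y) ∧
    ∀ N ∈ 𝓝ˢ (diagonal S), ∃ M ∈ 𝓝ˢ (diagonal S), ∀ x : ℤ → S,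
      (∀ n, (f (x n), x (n + 1)) ∈ M) → ∃ p, ∀ n : ℤ, (x n, (f ^ n) p) ∈ N

theorem IsTA.isDiagTA {S : Type*} [MetricSpace S] {f : S ≃ₜ S} (hf : IsTA f) : IsDiagTA f := by
  obtain ⟨⟨ε, hε, hpos, hexp⟩, hsh⟩ := hf
  refine ⟨⟨_, setOf_dist_lt_mem_nhdsSet_diagonal hε hpos, fun x y h => ?_⟩, fun N hN => ?_⟩
  · by_contra hxy
    obtain ⟨k, hk⟩ := hexp x y hxy
    exact absurd (h k) (not_lt.2 hk.le)
  · obtain ⟨ρ, hρ, hρpos, hsub⟩ := exists_lipschitz_of_mem_nhdsSet_diagonal hN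
    obtain ⟨δ, hδ, hδpos, h⟩ := hsh ρ hρ.continuous hρpos
    refine ⟨_, setOf_dist_lt_mem_nhdsSet_diagonal hδ hδpos, fun x hx => ?_⟩
    obtain ⟨p, hp⟩ := h x hx
    exact ⟨p, fun n => hsub _ _ (hp n)⟩

/-- A pseudo-orbit of f⁻¹ read backwards is one of f once its jumps are pushed through f; hence the
pullback of `M` by f. -/
theorem IsDiagTA.inv {f : S ≃ₜ S} (hf : IsDiagTA f) : IsDiagTA f⁻¹ := by
  obtain ⟨⟨N, hN, hexp⟩, hsh⟩ := hf
  refine ⟨⟨N, hN, fun x y h => hexp x y fun k => ?_⟩, fun N hN => ?_⟩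
  · simpa using h (-k)
  · obtain ⟨M, hM, h⟩ := hsh N hN
    refine ⟨_, swap_mem_nhdsSet_diagonal (preimage_map_mem_nhdsSet_diagonal f.continuous hM),
      fun x hx => ?_⟩
    obtain ⟨p, hp⟩ := h (fun n => x (-n)) fun n => by
      have := hx (-(n + 1))
      simpa using this
    refine ⟨p, fun n => ?_⟩
    have := hp (-n)
    simpa using this

theorem pow_succ_apply' (f : S ≃ₜ S) (n : ℕ) (x : S) : (f ^ (n + 1)) x = f ((f ^ n) x) := by
  rw [pow_succ']; rfl

theorem pow_succ_apply (f : S ≃ₜ S) (n : ℕ) (x : S) : (f ^ (n + 1)) x = (f ^ n) (f x) := by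
  rw [pow_succ]; rfl

theorem pow_add_apply (f : S ≃ₜ S) (m n : ℕ) (x : S) : (f ^ (m + n)) x = (f ^ m) ((f ^ n) x) := by
  rw [pow_add]; rfl

theorem pow_inv_pow_apply (f : S ≃ₜ S) (n : ℕ) (x : S) : (f ^ n) ((f⁻¹ ^ n) x) = x := by
  rw [inv_pow]; exact (f ^ n).apply_symm_apply x

theorem inv_pow_pow_apply (f : S ≃ₜ S) (n : ℕ) (x : S) : (f⁻¹ ^ n) ((f ^ n) x) = x := by
  rw [inv_pow]; exact (f ^ n).symm_apply_apply x

theorem apply_inv_pow_succ (f : S ≃ₜ S) (n : ℕ) (x : S) :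
    f ((f⁻¹ ^ (n + 1)) x) = (f⁻¹ ^ n) x := by
  rw [pow_succ_apply']; exact f.apply_symm_apply _

/-- There is a finite pseudo-orbit with at least one step from `x` to `y`, whose jumps are in
`M`. -/
def Chain (f : S ≃ₜ S) (M : Set (S × S)) : S → S → Prop :=
  Relation.TransGen fun a b => (f a, b) ∈ M

/-- There are pseudo-orbits with arbitrarily small jumps from `x` to `y`. -/
def Leads (f : S ≃ₜ S) (x y : S) : Prop :=
  ∀ M ∈ 𝓝ˢ (diagonal S), Chain f M x y

/-- `w` is a cluster point of the forward orbit of `x`. -/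
def Clusters (f : S ≃ₜ S) (x w : S) : Prop :=
  MapClusterPt w atTop fun n : ℕ => (f ^ n) x

/-- `p` is a periodic point of `f`. -/
def IsPer (f : S ≃ₜ S) (p : S) : Prop :=
  ∃ m : ℕ, 1 ≤ m ∧ (f ^ m) p = p

variable {f : S ≃ₜ S} {M N : Set (S × S)} {x y z w p q : S}

theorem Chain.mono (h : Chain f M x y) (hMN : M ⊆ N) : Chain f N x y :=
  Relation.TransGen.mono (fun _ _ hab => hMN hab) _ _ h

theorem Chain.trans (h : Chain f M x y) (h' : Chain f M y z) : Chain f M x z :=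
  Relation.TransGen.trans h h'

theorem Chain.tail (h : Chain f M x y) (h' : (f y, z) ∈ M) : Chain f M x z :=
  Relation.TransGen.tail h h'

theorem Chain.head (h' : (f x, y) ∈ M) (h : Chain f M y z) : Chain f M x z :=
  Relation.TransGen.head h' h

theorem Leads.trans (h : Leads f x y) (h' : Leads f y z) : Leads f x z :=
  fun M hM => (h M hM).trans (h' M hM)

theorem leads_pow_succ (f : S ≃ₜ S) (n : ℕ) (x : S) : Leads f x ((f ^ (n + 1)) x) := by
  intro M hM
  induction n with
  | zero => exact Relation.TransGen.single (by simpa using refl_mem_of_mem_nhdsSet_diagonal hM _)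
  | succ n ih =>
    refine ih.tail ?_
    rw [pow_succ_apply' f (n + 1)]
    exact refl_mem_of_mem_nhdsSet_diagonal hM _

theorem leads_apply (f : S ≃ₜ S) (x : S) : Leads f x (f x) := by
  simpa using leads_pow_succ f 0 x

theorem leads_from_inv_pow (f : S ≃ₜ S) (n : ℕ) (x : S) : Leads f ((f⁻¹ ^ (n + 1)) x) x := by
  have := leads_pow_succ f n ((f⁻¹ ^ (n + 1)) x)
  rwa [pow_inv_pow_apply] at this

/-- The last jump absorbs a displacement of the end point, at the cost of a coarser scale. -/
theorem Chain.right (h : Chain f M x y) (hMN : ∀ a b c, (a, b) ∈ M → (b, c) ∈ M → (a, c) ∈ N)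
    (hsub : M ⊆ N) (hz : (y, z) ∈ M) : Chain f N x z := by
  rcases h with h | ⟨h, h'⟩
  · exact Relation.TransGen.single (hMN _ _ _ h hz)
  · exact (Chain.mono h hsub).tail (hMN _ _ _ h' hz)

theorem Chain.left (h : Chain f M x y) (hMN : ∀ a b c, (a, b) ∈ M → (b, c) ∈ M → (a, c) ∈ N)
    (hsub : M ⊆ N) (hz : (f z, f x) ∈ M) : Chain f N z y := by
  rcases Relation.TransGen.head'_iff.1 h with ⟨b, hb, hby⟩
  rcases Relation.reflTransGen_iff_eq_or_transGen.1 hby with rfl | hby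
  · exact Relation.TransGen.single (hMN _ _ _ hz hb)
  · exact Chain.head (hMN _ _ _ hz hb) (Chain.mono hby hsub)

theorem Chain.exists_seq (h : Chain f M x y) : ∃ (n : ℕ) (c : ℕ → S), 1 ≤ n ∧ c 0 = x ∧ c n = y ∧
    ∀ i < n, (f (c i), c (i + 1)) ∈ M := by
  induction h using Relation.TransGen.head_induction_on with
  | single h =>
    rename_i a
    exact ⟨1, fun i => if i = 0 then a else y, le_rfl, by simp, by simp, fun i hi => by
      obtain rfl : i = 0 := by omega
      simpa using h⟩
  | head h hby ih =>
    rename_i a b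
    obtain ⟨n, c, hn, h0, hcn, hc⟩ := ih
    refine ⟨n + 1, fun i => Nat.casesOn i a c, by omega, rfl, hcn, fun i hi => ?_⟩
    cases i with
    | zero => simpa [h0] using h
    | succ i => exact hc i (by omega)

theorem Clusters.exists_ge (h : Clusters f x w) {U : Set S} (hU : U ∈ 𝓝 w) (m : ℕ) :
    ∃ n ≥ m, (f ^ n) x ∈ U :=
  (frequently_atTop.1 ((mapClusterPt_iff_frequently.1 h) U hU)) m

theorem clusters_of_exists_ge (h : ∀ U ∈ 𝓝 w, ∀ m : ℕ, ∃ n ≥ m, (f ^ n) x ∈ U) :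
    Clusters f x w :=
  mapClusterPt_iff_frequently.2 fun U hU => frequently_atTop.2 (h U hU)

theorem Clusters.pow (h : Clusters f x w) (k : ℕ) : Clusters f ((f ^ k) x) w :=
  clusters_of_exists_ge fun U hU m => by
    obtain ⟨n, hn, hU⟩ := h.exists_ge hU (m + k)
    refine ⟨n - k, by omega, ?_⟩
    rwa [← pow_add_apply, Nat.sub_add_cancel (by omega)]

theorem slice_mem_nhds (hM : M ∈ 𝓝ˢ (diagonal S)) (x : S) : {y | (x, y) ∈ M} ∈ 𝓝 x := by
  obtain ⟨U, hU, hx, h⟩ := exists_open_prod_subset hM x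
  exact mem_of_superset (hU.mem_nhds hx) fun y hy => h x hx y hy

theorem slice_mem_nhds' (hM : M ∈ 𝓝ˢ (diagonal S)) (x : S) : {y | (y, x) ∈ M} ∈ 𝓝 x := by
  obtain ⟨U, hU, hx, h⟩ := exists_open_prod_subset hM x
  exact mem_of_superset (hU.mem_nhds hx) fun y hy => h y hy x hx

theorem Clusters.leads (h : Clusters f x w) : Leads f x w := by
  intro M hM
  obtain ⟨n, hn, hU⟩ := h.exists_ge (slice_mem_nhds' hM w) 2
  obtain ⟨k, rfl⟩ : ∃ k, n = k + 1 + 1 := ⟨n - 2, by omega⟩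
  refine (leads_pow_succ f k x M hM).tail ?_
  rw [← pow_succ_apply']
  exact hU

/-- From `w` one jumps onto the orbit of `x` and follows it until it is back near `w`. -/
theorem Clusters.leads_self (h : Clusters f x w) : Leads f w w := by
  intro M hM
  obtain ⟨n, -, hU⟩ := h.exists_ge
    (slice_mem_nhds (preimage_map_mem_nhdsSet_diagonal f.continuous hM) w) 0
  refine Chain.head hU ?_
  rw [← pow_succ_apply']
  exact (h.pow _).leads M hM

theorem Clusters.leads_inv (h : Clusters f⁻¹ x w) : Leads f w x := by
  intro M hM
  obtain ⟨n, hn, hU⟩ := h.exists_ge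
    (slice_mem_nhds (preimage_map_mem_nhdsSet_diagonal f.continuous hM) w) 2
  obtain ⟨k, rfl⟩ : ∃ k, n = k + 1 + 1 := ⟨n - 2, by omega⟩
  refine Chain.head hU ?_
  simp only
  rw [apply_inv_pow_succ]
  exact leads_from_inv_pow f k x M hM

theorem Clusters.leads_self_inv (h : Clusters f⁻¹ x w) : Leads f w w := by
  intro M hM
  obtain ⟨n, hn, hU⟩ := h.exists_ge (slice_mem_nhds' hM w) 0
  refine ((h.pow (n + 1)).leads_inv M hM).tail ?_
  rw [apply_inv_pow_succ]
  exact hU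

theorem mem_nonwanderingSet_of_isPer (hp : IsPer f p) : p ∈ nonwanderingSet f := by
  obtain ⟨m, hm, h⟩ := hp
  exact fun U _ hpU => ⟨m, hm, p, ⟨p, hpU, h⟩, hpU⟩

theorem isClosed_nonwanderingSet (f : S ≃ₜ S) : IsClosed (nonwanderingSet f) := by
  refine isClosed_of_closure_subset fun x hx U hU hxU => ?_
  obtain ⟨y, hyU, hy⟩ := mem_closure_iff.1 hx U hU hxU
  exact hy U hU hyU

theorem IsPer.pow_mul {m : ℕ} (h : (f ^ m) p = p) (k : ℕ) : (f ^ (m * k)) p = p := by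
  induction k with
  | zero => simp
  | succ k ih => rw [Nat.mul_succ, pow_add_apply, h, ih]

theorem IsPer.apply (hp : IsPer f p) : IsPer f (f p) := by
  obtain ⟨m, hm, h⟩ := hp
  exact ⟨m, hm, by rw [← pow_succ_apply, pow_succ_apply', h]⟩

theorem IsPer.pow (hp : IsPer f p) (n : ℕ) : IsPer f ((f ^ n) p) := by
  induction n with
  | zero => simpa
  | succ n ih => rw [pow_succ_apply']; exact ih.apply

theorem IsPer.inv (hp : IsPer f p) : IsPer f⁻¹ p := by
  obtain ⟨m, hm, h⟩ := hp
  refine ⟨m, hm, ?_⟩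
  conv_lhs => rw [← h]
  exact inv_pow_pow_apply f m p

theorem IsPer.leads (hp : IsPer f p) (n : ℕ) : Leads f p ((f ^ n) p) := by
  obtain ⟨m, hm, h⟩ := hp
  obtain ⟨k, hk⟩ : ∃ k, n + m = k + 1 := ⟨n + m - 1, by omega⟩
  have := leads_pow_succ f k p
  rwa [← hk, pow_add_apply, h] at this

theorem IsPer.leads_back (hp : IsPer f p) (n : ℕ) : Leads f ((f ^ n) p) p := by
  obtain ⟨m, hm, h⟩ := hp
  have hk : m * (n + 1) = (m * (n + 1) - n) + n := by
    have : n + 1 ≤ m * (n + 1) := Nat.le_mul_of_pos_left _ hm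
    omega
  obtain ⟨l, hl⟩ : ∃ l, m * (n + 1) - n = l + 1 := ⟨m * (n + 1) - n - 1, by
    have : n + 1 ≤ m * (n + 1) := Nat.le_mul_of_pos_left _ hm
    omega⟩
  have := leads_pow_succ f l ((f ^ n) p)
  rwa [← hl, ← pow_add_apply, ← hk, IsPer.pow_mul h] at this

theorem nonwanderingSet_inv (f : S ≃ₜ S) : nonwanderingSet f⁻¹ = nonwanderingSet f := by
  have key : ∀ f : S ≃ₜ S, nonwanderingSet f ⊆ nonwanderingSet f⁻¹ := by
    intro f x hx U hU hxU
    obtain ⟨n, hn, y, ⟨z, hz, rfl⟩, hyU⟩ := hx U hU hxU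
    exact ⟨n, hn, z, ⟨_, hyU, inv_pow_pow_apply f n z⟩, hz⟩
  refine (key f⁻¹).trans_eq (by rw [inv_inv]) |>.antisymm (key f)

theorem IsSpectralDecomposition.of_inv {B : Set (Set S)} (h : IsSpectralDecomposition f⁻¹ B) :
    IsSpectralDecomposition f B where
  sUnion_eq := h.sUnion_eq.trans (nonwanderingSet_inv f)
  pairwiseDisjoint := h.pairwiseDisjoint
  nonempty := h.nonempty
  isClosed := h.isClosed
  invariant L hL := by
    have h1 := h.invariant L hL
    conv_lhs => rw [← h1]
    rw [← image_comp]
    have : (⇑f ∘ ⇑f⁻¹ : S → S) = id := funext fun x => f.apply_symm_apply x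
    rw [this, image_id]
  transitive L hL U V hU hV hLU hLV := by
    obtain ⟨n, y, ⟨z, hz, rfl⟩, hy⟩ := h.transitive L hL V U hV hU hLV hLU
    exact ⟨n, z, ⟨_, hy, pow_inv_pow_apply f n z⟩, hz⟩

end Chains

/-! ### Recurrence by chains and shadowing with a prescribed past. -/

section MetricChains

variable {S : Type*} [MetricSpace S] {f : S ≃ₜ S} {x : S}

theorem leads_self_of_mem_nonwanderingSet (hx : x ∈ nonwanderingSet f) : Leads f x x := by
  intro M hM
  obtain ⟨M₁, hM₁, -, hsub₁, -, hc₁⟩ := exists_symm_comp_nhdsSet_diagonal hM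
  obtain ⟨M₂, hM₂, -, hsub₂, -, hc₂⟩ := exists_symm_comp_nhdsSet_diagonal hM₁
  have hU : {u | (f x, f u) ∈ M₂} ∩ {u | (u, x) ∈ M₁} ∈ 𝓝 x :=
    inter_mem (slice_mem_nhds (preimage_map_mem_nhdsSet_diagonal f.continuous hM₂) x)
      (slice_mem_nhds' hM₁ x)
  obtain ⟨U, hUs, hUo, hxU⟩ := mem_nhds_iff.1 hU
  obtain ⟨n, hn, y, ⟨u, hu, rfl⟩, hy⟩ := hx U hUo hxU
  obtain ⟨k, rfl⟩ : ∃ k, n = k + 1 := ⟨n - 1, by omega⟩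
  exact ((leads_pow_succ f k u M₂ hM₂).left hc₂ hsub₂ (hUs hu).1).right hc₁ hsub₁ (hUs hy).2

/-- The sequence is extended to negative times by the true backward orbit of `c 0`, where no jump
occurs. -/
theorem IsDiagTA.exists_half_shadow (hf : IsDiagTA f) {N : Set (S × S)}
    (hN : N ∈ 𝓝ˢ (diagonal S)) : ∃ M ∈ 𝓝ˢ (diagonal S), IsOpen M ∧
      ∀ c : ℕ → S, (∀ n, (f (c n), c (n + 1)) ∈ M) →
        ∃ z, (∀ n : ℕ, ((f⁻¹ ^ n) (c 0), (f⁻¹ ^ n) z) ∈ N) ∧ ∀ n : ℕ, (c n, (f ^ n) z) ∈ N := by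
  obtain ⟨M₀, hM₀, h⟩ := hf.2 N hN
  obtain ⟨M, hM, hMo, hsub⟩ := exists_open_mem_nhdsSet_diagonal hM₀
  refine ⟨M, hM, hMo, fun c hc => ?_⟩
  obtain ⟨z, hz⟩ := h (fun j => if 0 ≤ j then c j.toNat else (f ^ j) (c 0)) (fun j => by
    rcases lt_trichotomy j (-1) with hj | rfl | hj
    · rw [if_neg (by omega), if_neg (by omega), add_comm, zpow_add, zpow_one]
      exact refl_mem_of_mem_nhdsSet_diagonal hM₀ _
    · have : f ((f ^ (-1 : ℤ)) (c 0)) = c 0 := by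
        rw [zpow_neg_one]; exact f.apply_symm_apply _
      simpa [this] using refl_mem_of_mem_nhdsSet_diagonal hM₀ _
    · rw [if_pos (by omega), if_pos (by omega)]
      have : (j + 1).toNat = j.toNat + 1 := by omega
      rw [this]
      exact hsub (hc _))
  refine ⟨z, fun n => ?_, fun n => ?_⟩
  · have := hz (-(n : ℤ))
    rcases Nat.eq_zero_or_pos n with rfl | hn
    · simpa using this
    · rw [if_neg (by omega)] at this
      simpa [zpow_neg, inv_pow] using this
  · have := hz n
    simpa using this

end MetricChains

end TopAnosov

namespace TopAnosov

/-! ### Density of periodic points and the spectral decomposition. -/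

section Decomposition

variable {S : Type*} [MetricSpace S] {f : S ≃ₜ S}

/-- A point whose forward orbit stays close to a periodic orbit clusters at it. -/
theorem clusters_of_forward_close {N₀ N : Set (S × S)}
    (hexp : ∀ x y, (∀ k : ℤ, ((f ^ k) x, (f ^ k) y) ∈ N₀) → x = y) (hN : N ∈ 𝓝ˢ (diagonal S))
    (hcomp : ∀ x y z, (x, y) ∈ N → (y, z) ∈ N → (x, z) ∈ N₀)
    (hcpt : ∀ x, ∃ K, IsCompact K ∧ ∀ y, (x, y) ∈ N → y ∈ K) {q z : S} (hq : IsPer f q)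
    (hz : ∀ n : ℕ, 1 ≤ n → ((f ^ n) q, (f ^ n) z) ∈ N) : Clusters f z q := by
  obtain ⟨m, hm, hmq⟩ := hq
  obtain ⟨K, hK, hKsub⟩ := hcpt q
  -- Only positive times are used: in the heteroclinic application the shadowed sequence is not yet
  -- at `q` at time 0.
  have hmem : ∀ k : ℕ, (f ^ (m * (k + 1))) z ∈ K := fun k => hKsub _ <| by
    have := hz (m * (k + 1)) (Nat.mul_pos hm (Nat.succ_pos k))
    rwa [IsPer.pow_mul hmq] at this
  obtain ⟨v, -, hv⟩ := hK.exists_mapClusterPt (f := atTop)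
    (u := fun k : ℕ => (f ^ (m * (k + 1))) z) (tendsto_principal.2 (Eventually.of_forall hmem))
  -- For fixed `j` the times j + m(k+1) are eventually positive, so the limit `v` is close to `q`
  -- along its whole orbit.
  have hvq : q = v := hexp q v fun j => by
    have hU : {u | ((f ^ j) u, (f ^ j) v) ∈ N} ∈ 𝓝 v :=
      slice_mem_nhds' (preimage_map_mem_nhdsSet_diagonal (f ^ j).continuous hN) v
    obtain ⟨k, hk, hkU⟩ := frequently_atTop.1 (mapClusterPt_iff_frequently.1 hv _ hU) j.natAbs
    refine hcomp _ _ _ ?_ hkU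
    obtain ⟨l, hl⟩ : ∃ l : ℕ, j + ((m * (k + 1) : ℕ) : ℤ) = ((l + 1 : ℕ) : ℤ) := by
      have : k + 1 ≤ m * (k + 1) := Nat.le_mul_of_pos_left _ hm
      exact ⟨(j + ((m * (k + 1) : ℕ) : ℤ) - 1).toNat, by omega⟩
    have key : ∀ y, (f ^ j) ((f ^ (m * (k + 1))) y) = (f ^ (l + 1)) y := fun y => by
      rw [← zpow_natCast, ← zpow_natCast, ← hl, zpow_add]; rfl
    have := hz (l + 1) (by omega)
    rwa [← key, ← key, IsPer.pow_mul hmq] at this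
  subst hvq
  refine MapClusterPt.of_comp (φ := fun k : ℕ => m * (k + 1)) ?_ hv
  exact tendsto_atTop_mono (fun k => (Nat.le_succ k).trans (Nat.le_mul_of_pos_left _ hm)) tendsto_id

/-- Two points joined by small chains in both directions are shadowed by a periodic orbit. -/
theorem IsDiagTA.exists_isPer_shadow (hf : IsDiagTA f) {N : Set (S × S)}
    (hN : N ∈ 𝓝ˢ (diagonal S)) : ∃ M ∈ 𝓝ˢ (diagonal S), ∀ x y, Chain f M x y → Chain f M y x →
      ∃ (r : S) (k : ℕ), IsPer f r ∧ (x, r) ∈ N ∧ (y, (f ^ k) r) ∈ N := by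
  obtain ⟨⟨N₀, hN₀, hexp⟩, hsh⟩ := hf
  obtain ⟨N₁, hN₁, -, -, hsymm, hcomp⟩ := exists_symm_comp_nhdsSet_diagonal hN₀
  obtain ⟨M, hM, h⟩ := hsh (N₁ ∩ N) (inter_mem hN₁ hN)
  refine ⟨M, hM, fun x y hxy hyx => ?_⟩
  obtain ⟨n, c, hn, hc0, hcn, hc⟩ := hxy.exists_seq
  obtain ⟨m, d, hm, hd0, hdm, hd⟩ := hyx.exists_seq
  set L := n + m with hL
  set e : ℕ → S := fun i => if i ≤ n then c i else d (i - n) with he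
  have he0 : e 0 = x := by simp [he, hc0]
  have hen : e n = y := by simp [he, hcn]
  have heL : e L = x := by simp only [he, hL]; rw [if_neg (by omega)]; simpa using hdm
  have hestep : ∀ i < L, (f (e i), e (i + 1)) ∈ M := by
    intro i hi
    rcases lt_trichotomy i n with hin | rfl | hin
    · simp only [he]; rw [if_pos (by omega), if_pos (by omega)]; exact hc i hin
    · rw [hen]; simp only [he]; rw [if_neg (by omega), Nat.add_sub_cancel_left, ← hd0]
      exact hd 0 (by omega)
    · simp only [he]; rw [if_neg (by omega), if_neg (by omega)]
      have := hd (i - n) (by omega)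
      rwa [show i - n + 1 = i + 1 - n by omega] at this
  -- The loop `e` of length `L` is repeated periodically. Both `r` and its `L`-th image shadow it,
  -- so expansivity identifies them.
  obtain ⟨r, hr⟩ := h (fun j => e (j % L).toNat) fun j => by
    have h1 := Int.emod_nonneg j (show (L : ℤ) ≠ 0 by omega)
    have h2 := Int.emod_lt_of_pos j (show (0 : ℤ) < L by omega)
    have := hestep (j % L).toNat (by omega)
    by_cases hlt : j % L + 1 < L
    · have h3 : (j + 1) % (L : ℤ) = j % L + 1 := by
        rw [← Int.emod_add_emod, Int.emod_eq_of_lt (by omega) hlt]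
      rw [h3, show (j % (L : ℤ) + 1).toNat = (j % (L : ℤ)).toNat + 1 by omega]
      exact this
    · have h4 : j % (L : ℤ) + 1 = L := by omega
      have h3 : (j + 1) % (L : ℤ) = 0 := by
        rw [← Int.emod_add_emod, h4, Int.emod_self]
      rw [show (j % (L : ℤ)).toNat + 1 = L by omega, heL] at this
      rw [h3]
      simpa [he0] using this
  have hper : r = (f ^ L) r := hexp _ _ fun j => by
    refine hcomp _ _ _ (hsymm _ _ (hr j).1) ?_
    have := (hr (j + L)).1
    rw [Int.add_emod_right, zpow_add] at this
    simpa using this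
  refine ⟨r, n, ⟨L, by omega, hper.symm⟩, ?_, ?_⟩
  · have := (hr 0).2
    simpa [he0] using this
  · have := (hr n).2
    rw [Int.emod_eq_of_lt (by omega) (by omega)] at this
    simpa [hen] using this

theorem IsDiagTA.exists_isPer_near_of_leads (hf : IsDiagTA f) {x : S} (hx : Leads f x x)
    {N : Set (S × S)} (hN : N ∈ 𝓝ˢ (diagonal S)) : ∃ p, IsPer f p ∧ (x, p) ∈ N := by
  obtain ⟨M, hM, h⟩ := hf.exists_isPer_shadow hN
  obtain ⟨r, -, hr, hxr, -⟩ := h x x (hx M hM) (hx M hM)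
  exact ⟨r, hr, hxr⟩

theorem IsDiagTA.mem_nonwanderingSet_iff (hf : IsDiagTA f) {x : S} :
    x ∈ nonwanderingSet f ↔ Leads f x x := by
  refine ⟨leads_self_of_mem_nonwanderingSet, fun hx U hU hxU => ?_⟩
  obtain ⟨p, hp, hxp⟩ := hf.exists_isPer_near_of_leads hx
    (point_mem_nhdsSet_diagonal (hU.mem_nhds hxU))
  exact mem_nonwanderingSet_of_isPer hp U hU (hxp rfl)

theorem IsDiagTA.exists_isPer_near (hf : IsDiagTA f) {x : S} (hx : x ∈ nonwanderingSet f)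
    {N : Set (S × S)} (hN : N ∈ 𝓝ˢ (diagonal S)) : ∃ p, IsPer f p ∧ (x, p) ∈ N :=
  hf.exists_isPer_near_of_leads (hf.mem_nonwanderingSet_iff.1 hx) hN

theorem IsDiagTA.exists_isPer_mem_nhds (hf : IsDiagTA f) {x : S} (hx : x ∈ nonwanderingSet f)
    {U : Set S} (hU : U ∈ 𝓝 x) : ∃ p ∈ U, IsPer f p := by
  obtain ⟨p, hp, hxp⟩ := hf.exists_isPer_near hx (point_mem_nhdsSet_diagonal hU)
  exact ⟨p, hxp rfl, hp⟩

variable [LocallyCompactSpace S]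

/-- The past of `p` followed by the future of `q` is a pseudo-orbit with one jump; its shadow is a
heteroclinic point clustering at `p` backward and at `q` forward. -/
theorem IsDiagTA.exists_leads_of_isPer (hf : IsDiagTA f) : ∃ N ∈ 𝓝ˢ (diagonal S),
    ∀ p q, IsPer f p → IsPer f q → (p, q) ∈ N → Leads f p q := by
  obtain ⟨N₀, hN₀, hexp⟩ := hf.1
  obtain ⟨C, hC, hCK⟩ := exists_compact_slices (S := S)
  obtain ⟨N, hN, -, hsub, -, hcomp⟩ := exists_symm_comp_nhdsSet_diagonal (inter_mem hN₀ hC)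
  obtain ⟨M, hM, -, h⟩ := hf.exists_half_shadow hN
  have hcpt : ∀ x, ∃ K, IsCompact K ∧ ∀ y, (x, y) ∈ N → y ∈ K := fun x => by
    obtain ⟨K, hK, hKs⟩ := hCK x
    exact ⟨K, hK, fun y hy => hKs y (hsub hy).2⟩
  refine ⟨_, preimage_map_mem_nhdsSet_diagonal f.continuous hM, fun p q hp hq hpq => ?_⟩
  obtain ⟨z, hpast, hfut⟩ := h (fun n => if n = 0 then p else (f ^ n) q) fun n => by
    rcases Nat.eq_zero_or_pos n with rfl | hn
    · simpa using hpq
    · rw [if_neg (by omega), if_neg (by omega), pow_succ_apply']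
      exact refl_mem_of_mem_nhdsSet_diagonal hM _
  have h1 : Clusters f z q := by
    refine clusters_of_forward_close hexp hN (fun x y z hxy hyz => (hcomp x y z hxy hyz).1)
      hcpt hq fun n hn => ?_
    have := hfut n
    rwa [if_neg (by omega)] at this
  have h2 : Clusters f⁻¹ z p := by
    refine clusters_of_forward_close (N₀ := N₀) (fun x y hxy => hexp x y fun k => ?_) hN
      (fun x y z hxy hyz => (hcomp x y z hxy hyz).1) hcpt hp.inv fun n _ => hpast n
    simpa using hxy (-k)
  exact h2.leads_inv.trans h1.leads

theorem IsDiagTA.exists_leads_of_near (hf : IsDiagTA f) : ∃ N ∈ 𝓝ˢ (diagonal S),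
    ∀ x ∈ nonwanderingSet f, ∀ y ∈ nonwanderingSet f, (x, y) ∈ N → Leads f x y := by
  obtain ⟨N₀, hN₀, h⟩ := hf.exists_leads_of_isPer
  obtain ⟨N, hN, hNo, hsub⟩ := exists_open_mem_nhdsSet_diagonal hN₀
  refine ⟨N, hN, fun x hx y hy hxy M hM => ?_⟩
  obtain ⟨M₁, hM₁, -, hsub₁, -, hc₁⟩ := exists_symm_comp_nhdsSet_diagonal hM
  obtain ⟨M₂, hM₂, -, hsub₂, -, hc₂⟩ := exists_symm_comp_nhdsSet_diagonal hM₁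
  obtain ⟨u, v, hu, hxu, hv, hyv, huv⟩ := mem_nhds_prod_iff'.1 (hNo.mem_nhds hxy)
  obtain ⟨p, ⟨hpu, hxp⟩, hp⟩ := hf.exists_isPer_mem_nhds hx (inter_mem (hu.mem_nhds hxu)
    (slice_mem_nhds (preimage_map_mem_nhdsSet_diagonal f.continuous hM₂) x))
  obtain ⟨q, ⟨hqv, hyq⟩, hq⟩ := hf.exists_isPer_mem_nhds hy (inter_mem (hv.mem_nhds hyv)
    (slice_mem_nhds' hM₁ y))
  exact ((h p q hp hq (hsub (huv ⟨hpu, hqv⟩)) M₂ hM₂).left hc₂ hsub₂ hxp).right hc₁ hsub₁ hyq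

/-- A symmetric neighborhood of the diagonal whose pairs of nonwandering points lead to each
other. -/
theorem IsDiagTA.exists_symm_leads_of_near (hf : IsDiagTA f) : ∃ N ∈ 𝓝ˢ (diagonal S),
    ∀ x ∈ nonwanderingSet f, ∀ y ∈ nonwanderingSet f, (x, y) ∈ N → Leads f x y ∧ Leads f y x := by
  obtain ⟨N, hN, h⟩ := hf.exists_leads_of_near
  exact ⟨N ∩ Prod.swap ⁻¹' N, inter_mem hN (swap_mem_nhdsSet_diagonal hN),
    fun x hx y hy hxy => ⟨h x hx y hy hxy.1, h y hy x hx hxy.2⟩⟩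

/-- Coarse chains both ways are shadowed by one periodic orbit, and nearby nonwandering points
already lead to each other at all scales. -/
theorem IsDiagTA.exists_leads_of_chain (hf : IsDiagTA f) : ∃ M ∈ 𝓝ˢ (diagonal S),
    ∀ x ∈ nonwanderingSet f, ∀ y ∈ nonwanderingSet f, Chain f M x y → Chain f M y x →
      Leads f x y := by
  obtain ⟨N, hN, h⟩ := hf.exists_symm_leads_of_near
  obtain ⟨M, hM, h'⟩ := hf.exists_isPer_shadow hN
  refine ⟨M, hM, fun x hx y hy hxy hyx => ?_⟩
  obtain ⟨r, k, hr, hxr, hyr⟩ := h' x y hxy hyx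
  exact ((h x hx r (mem_nonwanderingSet_of_isPer hr) hxr).1.trans (hr.leads k)).trans
    (h y hy _ (mem_nonwanderingSet_of_isPer (hr.pow k)) hyr).2

/-- The chain class of `x` in the nonwandering set. -/
def chainClass (f : S ≃ₜ S) (x : S) : Set S :=
  {y | y ∈ nonwanderingSet f ∧ Leads f x y ∧ Leads f y x}

/-- The way back from `f x` to `x` goes along a periodic orbit close to both. -/
theorem IsDiagTA.apply_mem_nonwanderingSet (hf : IsDiagTA f) {x : S}
    (hx : x ∈ nonwanderingSet f) :
    f x ∈ nonwanderingSet f ∧ Leads f (f x) x := by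
  have hfx : f x ∈ nonwanderingSet f := by
    intro U hU hxU
    obtain ⟨p, hpU, hp⟩ := hf.exists_isPer_mem_nhds hx
      (f.continuous.continuousAt.preimage_mem_nhds (hU.mem_nhds hxU))
    exact mem_nonwanderingSet_of_isPer hp.apply U hU hpU
  refine ⟨hfx, ?_⟩
  obtain ⟨N, hN, h⟩ := hf.exists_symm_leads_of_near
  obtain ⟨p, hp, h1, h2⟩ := hf.exists_isPer_near hx
    (inter_mem hN (preimage_map_mem_nhdsSet_diagonal f.continuous hN))
  have hp' := mem_nonwanderingSet_of_isPer hp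
  have hfp := mem_nonwanderingSet_of_isPer hp.apply
  exact ((h _ hfx _ hfp h2).1.trans (by simpa using hp.leads_back 1)).trans (h _ hx _ hp' h1).2

theorem IsDiagTA.symm_apply_mem_nonwanderingSet (hf : IsDiagTA f) {x : S}
    (hx : x ∈ nonwanderingSet f) : f.symm x ∈ nonwanderingSet f := by
  rw [← nonwanderingSet_inv] at hx ⊢
  exact (hf.inv.apply_mem_nonwanderingSet hx).1

/-- The uniform scale of `IsDiagTA.exists_symm_leads_of_near` makes classes closed; transitivity
comes from a periodic orbit of the class visiting both open sets. -/
theorem IsDiagTA.isSpectralDecomposition (hf : IsDiagTA f) :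
    IsSpectralDecomposition f (chainClass f '' nonwanderingSet f) where
  sUnion_eq := by
    ext y
    constructor
    · rintro ⟨_, ⟨x, -, rfl⟩, hy⟩
      exact hy.1
    · intro hy
      have := hf.mem_nonwanderingSet_iff.1 hy
      exact ⟨_, ⟨y, hy, rfl⟩, hy, this, this⟩
  pairwiseDisjoint := by
    rintro _ ⟨x, -, rfl⟩ _ ⟨y, -, rfl⟩ hne
    refine Set.disjoint_left.2 fun z hz hz' => hne ?_
    have hxy := hz.2.1.trans hz'.2.2
    have hyx := hz'.2.1.trans hz.2.2
    ext w
    exact ⟨fun hw => ⟨hw.1, hyx.trans hw.2.1, hw.2.2.trans hxy⟩,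
      fun hw => ⟨hw.1, hxy.trans hw.2.1, hw.2.2.trans hyx⟩⟩
  nonempty := by
    rintro _ ⟨x, hx, rfl⟩
    have := hf.mem_nonwanderingSet_iff.1 hx
    exact ⟨x, hx, this, this⟩
  isClosed := by
    rintro _ ⟨x, hx, rfl⟩
    obtain ⟨N, hN, h⟩ := hf.exists_symm_leads_of_near
    refine isClosed_of_closure_subset fun y hy => ?_
    have hyΩ : y ∈ nonwanderingSet f :=
      (isClosed_nonwanderingSet f).closure_subset_iff.2 (fun z hz => hz.1) hy
    obtain ⟨z, hzN, hz⟩ := mem_closure_iff_nhds.1 hy _ (slice_mem_nhds hN y)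
    have := h y hyΩ z hz.1 hzN
    exact ⟨hyΩ, hz.2.1.trans this.2, this.1.trans hz.2.2⟩
  invariant := by
    rintro _ ⟨x, hx, rfl⟩
    ext y
    constructor
    · rintro ⟨z, hz, rfl⟩
      have := hf.apply_mem_nonwanderingSet hz.1
      exact ⟨this.1, hz.2.1.trans (leads_apply f z), this.2.trans hz.2.2⟩
    · intro hy
      have h1 := hf.symm_apply_mem_nonwanderingSet hy.1
      have h2 := (hf.apply_mem_nonwanderingSet h1).2
      have h3 := leads_apply f (f.symm y)
      rw [f.apply_symm_apply] at h2 h3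
      exact ⟨f.symm y, ⟨h1, hy.2.1.trans h2, h3.trans hy.2.2⟩, f.apply_symm_apply y⟩
  transitive := by
    rintro _ ⟨x, hx, rfl⟩ U V hU hV ⟨a, ha, haU⟩ ⟨b, hb, hbV⟩
    obtain ⟨N, hN, h⟩ := hf.exists_symm_leads_of_near
    obtain ⟨M, hM, h'⟩ := hf.exists_isPer_shadow (inter_mem hN (inter_mem
      (point_mem_nhdsSet_diagonal (hU.mem_nhds haU))
      (point_mem_nhdsSet_diagonal (hV.mem_nhds hbV))))
    obtain ⟨r, k, hr, har, hbr⟩ := h' a b ((ha.2.2.trans hb.2.1) M hM)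
      ((hb.2.2.trans ha.2.1) M hM)
    have hrΩ := mem_nonwanderingSet_of_isPer hr
    have hrkΩ := mem_nonwanderingSet_of_isPer (hr.pow k)
    have h1 := h a ha.1 r hrΩ har.1
    have h2 := h b hb.1 _ hrkΩ hbr.1
    exact ⟨k, (f ^ k) r, ⟨r, ⟨⟨hrΩ, ha.2.1.trans h1.1, h1.2.trans ha.2.2⟩, har.2.1 rfl⟩, rfl⟩,
      ⟨hrkΩ, hb.2.1.trans h2.1, h2.2.trans hb.2.2⟩, hbr.2.2 rfl⟩

theorem IsDiagTA.isBasicSet_chainClass (hf : IsDiagTA f) {x : S} (hx : x ∈ nonwanderingSet f) :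
    IsBasicSet f (chainClass f x) :=
  ⟨_, hf.isSpectralDecomposition, x, hx, rfl⟩

end Decomposition

end TopAnosov

namespace TopAnosov

/-! ### Construction of an attracting class. -/

section Attractors

variable {S : Type*} [MetricSpace S] {f : S ≃ₜ S}

theorem mem_pow_image_iff (f : S ≃ₜ S) (n : ℕ) (U : Set S) (y : S) :
    y ∈ (f ^ n) '' U ↔ (f⁻¹ ^ n) y ∈ U := by
  constructor
  · rintro ⟨z, hz, rfl⟩
    rwa [inv_pow_pow_apply]
  · exact fun h => ⟨_, h, pow_inv_pow_apply f n y⟩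

theorem isOpen_setOf_chain {E : Set (S × S)} (hE : IsOpen E) (q : S) :
    IsOpen {y | Chain f E q y} := by
  refine isOpen_iff_mem_nhds.2 fun y hy => ?_
  rcases hy with h | ⟨h, h'⟩
  · filter_upwards [(hE.preimage (Continuous.prodMk_right (f q))).mem_nhds h] with z hz
    exact Relation.TransGen.single hz
  · rename_i b
    filter_upwards [(hE.preimage (Continuous.prodMk_right (f b))).mem_nhds h'] with z hz
    exact Chain.tail h hz

theorem exists_concat {M : Set (S × S)} {w : ℕ → S} (h : ∀ i, Chain f M (w i) (w (i + 1))) :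
    ∃ (c : ℕ → S) (t : ℕ → ℕ), StrictMono t ∧ (∀ n, (f (c n), c (n + 1)) ∈ M) ∧
      ∀ i, c (t i) = w i := by
  choose len path hlen h0 hl hstep using fun i => (h i).exists_seq
  -- The state at time `n` records the current chain and the position in it.
  let st : ℕ → ℕ × ℕ := fun n => Nat.rec (0, 0)
    (fun _ s => if s.2 + 1 < len s.1 then (s.1, s.2 + 1) else (s.1 + 1, 0)) n
  have hst : ∀ n, st (n + 1) = if (st n).2 + 1 < len (st n).1 then ((st n).1, (st n).2 + 1)
    else ((st n).1 + 1, 0) := fun n => rfl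
  have hlt : ∀ n, (st n).2 < len (st n).1 := fun n => by
    induction n with
    | zero => exact hlen 0
    | succ n ih =>
      rw [hst]
      split_ifs with hc
      · exact hc
      · exact hlen _
  let t : ℕ → ℕ := fun i => ∑ j ∈ Finset.range i, len j
  have ht : ∀ i, t (i + 1) = t i + len i := fun i => Finset.sum_range_succ _ _
  have hin : ∀ i, st (t i) = (i, 0) → ∀ k < len i, st (t i + k) = (i, k) := by
    intro i hi k
    induction k with
    | zero => exact fun _ => hi
    | succ k ih =>
      intro hk
      rw [← add_assoc, hst, ih (by omega), if_pos hk]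
  have hti : ∀ i, st (t i) = (i, 0) := fun i => by
    induction i with
    | zero => rfl
    | succ i ih =>
      have h1 := hlen i
      have h2 := hin i ih (len i - 1) (by omega)
      rw [ht, show t i + len i = t i + (len i - 1) + 1 by omega, hst, h2, if_neg (by simp; omega)]
  refine ⟨fun n => path (st n).1 (st n).2, t, strictMono_nat_of_lt_succ fun i => ?_, fun n => ?_,
    fun i => ?_⟩
  · have := hlen i
    rw [ht]
    omega
  · have h1 := hlt n
    have h2 := hstep (st n).1 (st n).2 h1
    simp only [hst]
    split_ifs with hc
    · exact h2
    · rw [show (st n).2 + 1 = len (st n).1 by omega, hl] at h2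
      simpa [h0] using h2
  · simp only [hti, h0]

theorem eq_of_forall_dist_lt {a b : S} (h : ∀ n : ℕ, dist a b < 1 / ((n : ℝ) + 1)) : a = b := by
  by_contra hab
  obtain ⟨n, hn⟩ := exists_nat_one_div_lt (dist_pos.2 hab)
  exact absurd (h n) (not_lt.2 hn.le)

/-- If the backward orbit of `x` escapes to infinity, then the forward orbits of all points close
to the forward orbit of `x` stay close to it. -/
theorem IsDiagTA.exists_forward_close (hf : IsDiagTA f) {x : S}
    (hx : ∀ w, ¬ Clusters f⁻¹ x w) {N : Set (S × S)} (hN : N ∈ 𝓝ˢ (diagonal S)) :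
    ∃ M ∈ 𝓝ˢ (diagonal S), ∀ (k : ℕ) (y : S), (f ((f ^ k) x), y) ∈ M →
      ∀ j : ℕ, ((f ^ j) y, (f ^ (j + 1 + k)) x) ∈ N := by
  -- Being close to the `n`-th preimage of `x` now means being carried by f^n to within 1/(n+1) of
  -- `x`; a shadow of the whole past must then pass through `x`.
  have hT := thin_mem_nhdsSet_diagonal hx
    (W := fun n => (f ^ n) ⁻¹' Metric.ball x (1 / ((n : ℝ) + 1)))
    fun n => by
      refine (f ^ n).continuous.continuousAt.preimage_mem_nhds ?_
      rw [pow_inv_pow_apply]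
      exact Metric.ball_mem_nhds x Nat.one_div_pos_of_nat
  obtain ⟨M, hM, -, h⟩ := hf.exists_half_shadow (inter_mem hN hT)
  refine ⟨M, hM, fun k y hy j => ?_⟩
  obtain ⟨z, hpast, hfut⟩ := h (fun n => if n = 0 then (f ^ k) x else (f ^ (n - 1)) y) fun n => by
    rcases Nat.eq_zero_or_pos n with rfl | hn
    · simpa using hy
    · rw [if_neg (by omega), if_neg (by omega), ← pow_succ_apply',
        show n - 1 + 1 = n + 1 - 1 by omega]
      exact refl_mem_of_mem_nhdsSet_diagonal hM _
  have hz : (f⁻¹ ^ k) z = x := eq_of_forall_dist_lt fun n => by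
    have : (f ^ n) ((f⁻¹ ^ (n + k)) z) ∈ Metric.ball x (1 / ((n : ℝ) + 1)) :=
      (hpast (n + k)).2 n (by simp only [if_true]; rw [pow_add_apply, inv_pow_pow_apply])
    rwa [pow_add_apply, pow_inv_pow_apply] at this
  have := (hfut (j + 1)).1
  rw [if_neg (by omega)] at this
  rwa [pow_add_apply f (j + 1), ← hz, pow_inv_pow_apply]

/-- If the forward orbit escaped too, thinning along it would force every point near `f x` to equal
`f x`, making it isolated. -/
theorem IsDiagTA.exists_clusters_of_escape (hf : IsDiagTA f) (hni : ∀ x : S, {x} ∉ 𝓝 x) {x : S}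
    (hx : ∀ w, ¬ Clusters f⁻¹ x w) : ∃ w, Clusters f x w := by
  by_contra! hω
  have hT := thin_mem_nhdsSet_diagonal (u := fun n => (f ^ (n + 1)) x)
    (W := fun n => (f⁻¹ ^ n) ⁻¹' Metric.ball (f x) (1 / ((n : ℝ) + 1)))
    (fun w hw => hω w (MapClusterPt.of_comp (φ := fun n => n + 1) (tendsto_add_atTop_nat 1) hw))
    fun n => by
      refine (f⁻¹ ^ n).continuous.continuousAt.preimage_mem_nhds ?_
      rw [pow_succ_apply, inv_pow_pow_apply]
      exact Metric.ball_mem_nhds _ Nat.one_div_pos_of_nat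
  obtain ⟨M, hM, h⟩ := hf.exists_forward_close hx (swap_mem_nhdsSet_diagonal hT)
  refine hni (f x) (mem_of_superset (slice_mem_nhds hM (f x)) fun y hy => ?_)
  refine eq_of_forall_dist_lt fun n => ?_
  have := h 0 y (by simpa using hy) n n rfl
  simpa only [Prod.fst_swap, Prod.snd_swap, mem_preimage, inv_pow_pow_apply,
    Metric.mem_ball] using this

theorem IsPer.forall_int_of_forall_nat {N : Set (S × S)} {p q : S} (hp : IsPer f p)
    (hq : IsPer f q) (h : ∀ n : ℕ, ((f ^ n) p, (f ^ n) q) ∈ N) (k : ℤ) :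
    ((f ^ k) p, (f ^ k) q) ∈ N := by
  obtain ⟨a, ha, hap⟩ := hp
  obtain ⟨b, hb, hbq⟩ := hq
  have hL : 1 ≤ a * b := Nat.mul_pos ha hb
  obtain ⟨l, hl⟩ : ∃ l : ℕ, k + ((a * b * k.natAbs : ℕ) : ℤ) = l :=
    ⟨(k + ((a * b * k.natAbs : ℕ) : ℤ)).toNat, by
      have : k.natAbs ≤ a * b * k.natAbs := Nat.le_mul_of_pos_left _ hL
      omega⟩
  have key : ∀ y, (f ^ (a * b * k.natAbs)) y = y → (f ^ k) y = (f ^ l) y := fun y hy => by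
    conv_lhs => rw [← hy]
    rw [← zpow_natCast, ← zpow_natCast, ← hl, zpow_add]; rfl
  rw [key p (by rw [mul_assoc]; exact IsPer.pow_mul hap _),
    key q (by rw [mul_comm a b, mul_assoc]; exact IsPer.pow_mul hbq _)]
  exact h l

theorem IsPer.finite_orbit {q : S} (hq : IsPer f q) : (range fun n : ℕ => (f ^ n) q).Finite := by
  obtain ⟨m, hm, hmq⟩ := hq
  refine ((finite_lt_nat m).image fun n => (f ^ n) q).subset ?_
  rintro _ ⟨n, rfl⟩
  refine ⟨n % m, Nat.mod_lt _ hm, ?_⟩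
  conv_rhs => simp only; rw [← Nat.mod_add_div n m, pow_add_apply, IsPer.pow_mul hmq]

theorem exists_clusters_of_mem_isCompact {K : Set S} (hK : IsCompact K) {g : S ≃ₜ S} {y : S}
    (h : ∀ n : ℕ, (g ^ n) y ∈ K) : ∃ w, Clusters g y w := by
  obtain ⟨w, -, hw⟩ := hK.exists_mapClusterPt (f := atTop) (u := fun n : ℕ => (g ^ n) y)
    (tendsto_principal.2 (Eventually.of_forall h))
  exact ⟨w, hw⟩

variable [LocallyCompactSpace S]

/-- If only points of the class of `q` can be reached from `q` by small chains, then this class is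
attracting. -/
theorem IsDiagTA.isAttracting_chainClass (hf : IsDiagTA f) {q : S}
    (hq : q ∈ nonwanderingSet f) {E : Set (S × S)} (hE : E ∈ 𝓝ˢ (diagonal S)) (hEo : IsOpen E)
    (hterm : ∀ w ∈ nonwanderingSet f, Chain f E q w → w ∈ chainClass f q)
    (hcl : ∀ y, (∀ n : ℕ, Chain f E q ((f⁻¹ ^ n) y)) →
      (∃ w, Clusters f⁻¹ y w) ∧ ∃ w, Clusters f y w) :
    IsAttracting f (chainClass f q) := by
  -- The reachable set is trapping because one further jump reaches every limit of images of its
  -- points.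
  refine ⟨{y | Chain f E q y}, isOpen_setOf_chain hEo q, fun y hy => hy.2.1 E hE, ?_, ?_⟩
  · intro y hy
    obtain ⟨_, hz, u, hu, rfl⟩ := mem_closure_iff_nhds.1 hy _ (slice_mem_nhds' hE y)
    exact Chain.tail hu hz
  · ext y
    simp only [mem_iInter, mem_pow_image_iff, mem_ofPred_eq]
    constructor
    -- Both cluster points of `y` are reachable, hence in the class of `q`; so `y` lies on chains
    -- from `q` to `q` at every scale.
    · intro hy
      obtain ⟨⟨w, hw⟩, w', hw'⟩ := hcl y hy
      have hwq : w ∈ chainClass f q := by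
        refine hterm w (hf.mem_nonwanderingSet_iff.2 hw.leads_self_inv) ?_
        obtain ⟨n, -, hn⟩ := hw.exists_ge (slice_mem_nhds' hE w) 0
        refine (hy (n + 1)).tail ?_
        rw [apply_inv_pow_succ]
        exact hn
      have hqy : Leads f q y := hwq.2.1.trans hw.leads_inv
      have hwq' : w' ∈ chainClass f q :=
        hterm w' (hf.mem_nonwanderingSet_iff.2 hw'.leads_self) ((hqy.trans hw'.leads) E hE)
      have hyq : Leads f y q := hw'.leads.trans hwq'.2.2
      exact ⟨hf.mem_nonwanderingSet_iff.2 (hyq.trans hqy), hqy, hyq⟩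
    · intro hy n
      have hn : ∀ n : ℕ, (f⁻¹ ^ n) y ∈ chainClass f q := fun n => by
        induction n with
        | zero => simpa
        | succ n ih =>
          rw [← hf.isSpectralDecomposition.invariant _ ⟨q, hq, rfl⟩] at ih
          obtain ⟨z, hz, hzn⟩ := ih
          rw [pow_succ_apply', ← hzn]
          simpa using hz
      exact (hn n).2.1 E hE

/-- An open set all of whose points have close forward orbits contains at most one periodic
point, and the orbit of this point is attracting. -/
theorem IsDiagTA.isAttracting_of_forward_close (hf : IsDiagTA f) {N₀ : Set (S × S)}
    (hN₀ : N₀ ∈ 𝓝ˢ (diagonal S))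
    (hexp : ∀ x y, (∀ k : ℤ, ((f ^ k) x, (f ^ k) y) ∈ N₀) → x = y) {W : Set S} (hW : IsOpen W)
    (hclose : ∀ x ∈ W, ∀ y ∈ W, ∀ n : ℕ, ((f ^ n) x, (f ^ n) y) ∈ N₀) {q : S} (hqW : q ∈ W)
    (hq : IsPer f q) : IsAttracting f (chainClass f q) := by
  have hqΩ := mem_nonwanderingSet_of_isPer hq
  have hΩW : ∀ y ∈ nonwanderingSet f, y ∈ W → y = q := by
    intro y hy hyW
    by_contra hne
    obtain ⟨r, ⟨hrW, hrq⟩, hr⟩ := hf.exists_isPer_mem_nhds hy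
      (inter_mem (hW.mem_nhds hyW) (isOpen_compl_singleton.mem_nhds hne : {q}ᶜ ∈ 𝓝 y))
    exact hrq (hexp r q (hr.forall_int_of_forall_nat hq (hclose r hrW q hqW)))
  have hΩinv : ∀ (i : ℕ) (v : S), (f ^ i) v ∈ nonwanderingSet f → v ∈ nonwanderingSet f := by
    intro i v
    induction i with
    | zero => simp
    | succ i ih =>
      intro h
      have := hf.symm_apply_mem_nonwanderingSet h
      rw [pow_succ_apply', f.symm_apply_apply] at this
      exact ih this
  obtain ⟨K, hK, hOK, hKW⟩ := exists_compact_between hq.finite_orbit.isCompact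
    (isOpen_iUnion fun i : ℕ => (f ^ i).isOpenMap _ hW)
    (show (range fun n : ℕ => (f ^ n) q) ⊆ ⋃ i : ℕ, (f ^ i) '' W by
      rintro _ ⟨n, rfl⟩
      exact mem_iUnion.2 ⟨n, q, hqW, rfl⟩)
  obtain ⟨E, hE, hEo, h⟩ := hf.exists_half_shadow (inter_mem hN₀ (inter_mem
    (swap_mem_nhdsSet_diagonal (closed_mem_nhdsSet_diagonal hq.finite_orbit.isClosed
      fun y hy => mem_interior_iff_mem_nhds.1 (hOK hy)))
    (point_mem_nhdsSet_diagonal (hW.mem_nhds hqW))))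
  -- A chain from `q`, preceded by the past of `q`, is shadowed by a point of `W`; expansivity makes
  -- it `q`, so the chain stays near this periodic orbit.
  have hreach : ∀ y, Chain f E q y → y ∈ K := by
    intro y hy
    obtain ⟨n, c, hn, hc0, hcn, hc⟩ := hy.exists_seq
    obtain ⟨z, hpast, hfut⟩ := h (fun i => if i ≤ n then c i else (f ^ (i - n)) y) fun i => by
      rcases lt_trichotomy i n with hi | rfl | hi
      · rw [if_pos (by omega), if_pos (by omega)]
        exact hc i hi
      · rw [if_pos le_rfl, if_neg (by omega), Nat.add_sub_cancel_left, hcn, pow_one]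
        exact refl_mem_of_mem_nhdsSet_diagonal hE _
      · rw [if_neg (by omega), if_neg (by omega), ← pow_succ_apply',
          show i - n + 1 = i + 1 - n by omega]
        exact refl_mem_of_mem_nhdsSet_diagonal hE _
    simp only [Nat.zero_le, if_true, hc0] at hpast
    have hzW : z ∈ W := by simpa using (hpast 0).2.2
    have hqz : q = z := hexp q z fun k => by
      obtain ⟨m, rfl | rfl⟩ := Int.eq_nat_or_neg k
      · simpa using hclose q hqW z hzW m
      · simpa [zpow_neg, inv_pow] using (hpast m).1
    have := (hfut n).2.1
    simp only [le_refl, if_true, hcn, ← hqz] at this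
    exact this ⟨n, rfl⟩
  refine hf.isAttracting_chainClass hqΩ hE hEo (fun w hw hqw => ?_) (fun y hy => ⟨?_, ?_⟩)
  · obtain ⟨i, v, hv, rfl⟩ := mem_iUnion.1 (hKW (hreach w hqw))
    obtain rfl := hΩW v (hΩinv i v hw) hv
    exact ⟨hw, hq.leads i, hq.leads_back i⟩
  · exact exists_clusters_of_mem_isCompact hK fun n => hreach _ (hy n)
  · refine exists_clusters_of_mem_isCompact hK fun n => hreach _ ?_
    have hy0 : Chain f E q y := by simpa using hy 0
    cases n with
    | zero => simpa using hy0
    | succ n => exact hy0.trans (leads_pow_succ f n y E hE)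

theorem IsDiagTA.exists_isAttracting_of_escape (hf : IsDiagTA f) (hni : ∀ x : S, {x} ∉ 𝓝 x)
    {x : S} (hx : ∀ w, ¬ Clusters f⁻¹ x w) :
    ∃ q ∈ nonwanderingSet f, IsAttracting f (chainClass f q) := by
  obtain ⟨N₀, hN₀, hexp⟩ := hf.1
  obtain ⟨N, hN, -, -, hsymm, hcomp⟩ := exists_symm_comp_nhdsSet_diagonal hN₀
  obtain ⟨M, hM, h⟩ := hf.exists_forward_close hx hN
  obtain ⟨p, hp⟩ := hf.exists_clusters_of_escape hni hx
  obtain ⟨W, hW, hpW, hWM⟩ := exists_open_prod_subset hM p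
  obtain ⟨n, hn, hnW⟩ := hp.exists_ge (hW.mem_nhds hpW) 1
  obtain ⟨k, rfl⟩ : ∃ k, n = k + 1 := ⟨n - 1, by omega⟩
  rw [pow_succ_apply'] at hnW
  obtain ⟨q, hqW, hq⟩ := hf.exists_isPer_mem_nhds
    (hf.mem_nonwanderingSet_iff.2 hp.leads_self) (hW.mem_nhds hpW)
  exact ⟨q, mem_nonwanderingSet_of_isPer hq, hf.isAttracting_of_forward_close hN₀ hexp hW
    (fun a ha b hb j => hcomp _ _ _ (h k a (hWM _ hnW _ ha) j)
      (hsymm _ _ (h k b (hWM _ hnW _ hb) j))) hqW hq⟩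

theorem IsDiagTA.exists_isAttracting_of_clusters (hf : IsDiagTA f) [Nonempty S]
    (hα : ∀ x : S, ∃ w, Clusters f⁻¹ x w) (hω : ∀ x : S, ∃ w, Clusters f x w) :
    ∃ q ∈ nonwanderingSet f, IsAttracting f (chainClass f q) := by
  obtain ⟨M₁, hM₁, hA⟩ := hf.exists_leads_of_chain
  obtain ⟨M₂, hM₂, -, hsub₂, -, hc₂⟩ := exists_symm_comp_nhdsSet_diagonal hM₁
  obtain ⟨M₃, hM₃, -, hsub₃, -, hc₃⟩ := exists_symm_comp_nhdsSet_diagonal hM₂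
  obtain ⟨M, hM, -, h⟩ := hf.exists_half_shadow (inter_mem
    (preimage_map_mem_nhdsSet_diagonal f.continuous hM₃) (swap_mem_nhdsSet_diagonal hM₂))
  obtain ⟨E, hE, hEo, hEsub⟩ := exists_open_mem_nhdsSet_diagonal (inter_mem hM hM₁)
  suffices hterm : ∃ q ∈ nonwanderingSet f, ∀ w ∈ nonwanderingSet f, Chain f E q w →
      w ∈ chainClass f q by
    obtain ⟨q, hq, hqt⟩ := hterm
    exact ⟨q, hq, hf.isAttracting_chainClass hq hE hEo hqt (fun y _ => ⟨hα y, hω y⟩)⟩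
  -- Without a terminal class, chains leaving one class after another concatenate to an infinite
  -- pseudo-orbit.
  by_contra! hcon
  choose! g hgΩ hgc hgn using hcon
  obtain ⟨x⟩ := ‹Nonempty S›
  obtain ⟨w₀, hw₀⟩ := hω x
  have hwΩ : ∀ i, g^[i] w₀ ∈ nonwanderingSet f := fun i => by
    induction i with
    | zero => exact hf.mem_nonwanderingSet_iff.2 hw₀.leads_self
    | succ i ih => rw [Function.iterate_succ_apply']; exact hgΩ _ ih
  have hwc : ∀ i, Chain f E (g^[i] w₀) (g^[i + 1] w₀) := fun i => by
    rw [Function.iterate_succ_apply']; exact hgc _ (hwΩ i)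
  obtain ⟨c, t, ht, hc, hct⟩ := exists_concat hwc
  obtain ⟨z, -, hz⟩ := h c fun n => (hEsub (hc n)).1
  obtain ⟨v, hv⟩ := hω z
  obtain ⟨G, hG, hvG, hGM⟩ := exists_open_prod_subset hM₃ v
  obtain ⟨a, -, haG⟩ := hv.exists_ge (hG.mem_nhds hvG) 0
  have hta : a + 1 ≤ t (a + 1) := ht.le_apply
  -- The times satisfy a < t (a+1) < t (a+2) < b, and the shadow is near `v` at `a` and `b`.
  -- Following it from t (a+2) to just before `b`, jumping back to `a` and going on to t (a+1)
  -- reverses one chain.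
  obtain ⟨b, hb, hbG⟩ := hv.exists_ge (hG.mem_nhds hvG) (t (a + 2) + 2)
  obtain ⟨k, hk⟩ : ∃ k, t (a + 1) = k + 1 + a := ⟨t (a + 1) - 1 - a, by omega⟩
  obtain ⟨l, hl⟩ : ∃ l, b = (l + 1 + t (a + 2)) + 1 := ⟨b - 2 - t (a + 2), by omega⟩
  have h1 : Chain f M₃ ((f ^ t (a + 2)) z) ((f ^ a) z) := by
    refine (leads_pow_succ f l _ M₃ hM₃).tail ?_
    rw [← pow_add_apply, ← pow_succ_apply', ← hl]
    exact hGM _ hbG _ haG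
  have h2 : Chain f M₃ ((f ^ a) z) ((f ^ t (a + 1)) z) := by
    rw [hk, pow_add_apply]
    exact leads_pow_succ f k _ M₃ hM₃
  have h3 := ((h1.trans h2).left hc₃ hsub₃ (hz (t (a + 2))).1).right hc₂ hsub₂ (hz (t (a + 1))).2
  rw [hct, hct] at h3
  have h4 := (hwc (a + 1)).mono fun z hz => (hEsub hz).2
  have h5 := hgn _ (hwΩ (a + 1))
  rw [← Function.iterate_succ_apply' g] at h5
  exact h5 ⟨hwΩ _, hA _ (hwΩ _) _ (hwΩ _) h4 h3, hA _ (hwΩ _) _ (hwΩ _) h3 h4⟩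

theorem IsDiagTA.exists_isBasicSet (hf : IsDiagTA f) [Nonempty S] (hni : ∀ x : S, {x} ∉ 𝓝 x) :
    ∃ L : Set S, IsBasicSet f L ∧ (IsAttracting f L ∨ IsRepelling f L) := by
  by_cases hα : ∃ x, ∀ w, ¬ Clusters f⁻¹ x w
  · obtain ⟨x, hx⟩ := hα
    obtain ⟨q, hq, h⟩ := hf.exists_isAttracting_of_escape hni hx
    exact ⟨_, hf.isBasicSet_chainClass hq, Or.inl h⟩
  by_cases hω : ∃ x, ∀ w, ¬ Clusters f x w
  · obtain ⟨x, hx⟩ := hω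
    obtain ⟨q, hq, h⟩ := hf.inv.exists_isAttracting_of_escape hni
      (x := x) (by rwa [inv_inv])
    obtain ⟨B, hB, hqB⟩ := hf.inv.isBasicSet_chainClass hq
    exact ⟨_, ⟨B, hB.of_inv, hqB⟩, Or.inr h⟩
  push Not at hα hω
  obtain ⟨q, hq, h⟩ := hf.exists_isAttracting_of_clusters hα hω
  exact ⟨_, hf.isBasicSet_chainClass hq, Or.inl h⟩

end Attractors

/-! ### Attracting and repelling basic sets are not saddles. -/

section Saddles

variable {S : Type*} [MetricSpace S] {f : S ≃ₜ S} {L : Set S}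

theorem IsBasicSet.subset_nonwanderingSet (hL : IsBasicSet f L) : L ⊆ nonwanderingSet f := by
  obtain ⟨B, hB, hLB⟩ := hL
  rw [← hB.sUnion_eq]
  exact subset_sUnion_of_mem hLB

/-- A point whose backward orbit clusters in an attracting set belongs to it. -/
theorem IsAttracting.mem_of_clusters_inv (hL : IsAttracting f L) {y w : S} (hw : w ∈ L)
    (hy : Clusters f⁻¹ y w) : y ∈ L := by
  obtain ⟨U, hU, hLU, hclo, hint⟩ := hL
  rw [← hint]
  -- As f(U) ⊆ U, a visit of the backward orbit to `U` puts all its earlier terms in `U`.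
  have hmono : ∀ (k n : ℕ), (f⁻¹ ^ (n + k)) y ∈ U → (f⁻¹ ^ n) y ∈ U := by
    intro k n h
    induction k with
    | zero => exact h
    | succ k ih =>
      refine ih (hclo (subset_closure ⟨_, h, ?_⟩))
      rw [← add_assoc, apply_inv_pow_succ]
  refine mem_iInter.2 fun n => (mem_pow_image_iff f n U y).2 ?_
  obtain ⟨m, hm, hmU⟩ := hy.exists_ge (hU.mem_nhds (hLU hw)) n
  obtain ⟨k, rfl⟩ := Nat.exists_eq_add_of_le hm
  exact hmono k n hmU

theorem clusters_of_mem_omegaSet {y w : S} (h : w ∈ omegaSet f y) : Clusters f y w := by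
  rw [omegaSet, mem_omegaLimit_singleton_iff_mapClusterPt, mapClusterPt_iff_frequently] at h
  refine clusters_of_exists_ge fun U hU m => ?_
  obtain ⟨k, hk, hkU⟩ := frequently_atTop.1 (h U hU) m
  lift k to ℕ using by omega
  exact ⟨k, by omega, by simpa using hkU⟩

theorem clusters_inv_of_mem_alphaSet {y w : S} (h : w ∈ alphaSet f y) : Clusters f⁻¹ y w := by
  rw [alphaSet, mem_omegaLimit_singleton_iff_mapClusterPt, mapClusterPt_iff_frequently] at h
  refine clusters_of_exists_ge fun U hU m => ?_
  obtain ⟨k, hk, hkU⟩ := frequently_atBot.1 (h U hU) (-m)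
  obtain ⟨n, rfl⟩ : ∃ n : ℕ, k = -n := ⟨(-k).toNat, by omega⟩
  exact ⟨n, by omega, by simpa [zpow_neg, inv_pow] using hkU⟩

theorem IsBasicSet.not_isSaddle (hL : IsBasicSet f L) (h : IsAttracting f L ∨ IsRepelling f L) :
    ¬ IsSaddle f L := by
  rintro ⟨⟨x, hx, ⟨a, ha⟩, hxL⟩, y, hy, ⟨b, hb⟩, hyL⟩
  rcases h with h | h
  · exact hy (hL.subset_nonwanderingSet
      (h.mem_of_clusters_inv (hyL hb) (clusters_inv_of_mem_alphaSet hb)))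
  · refine hx (hL.subset_nonwanderingSet (IsAttracting.mem_of_clusters_inv h (hxL ha) ?_))
    rw [inv_inv]
    exact clusters_of_mem_omegaSet ha

end Saddles

theorem singleton_notMem_nhds_of_chartedSpace {S : Type*} [TopologicalSpace S] [T1Space S]
    [ChartedSpace (EuclideanSpace ℝ (Fin 2)) S] (x : S) : {x} ∉ 𝓝 x := by
  intro h
  have hx : IsOpen {x} := isOpen_singleton_iff_nhds_eq_pure x |>.2
    (le_antisymm (le_pure_iff.2 h) (pure_le_nhds x))
  have := (chartAt (EuclideanSpace ℝ (Fin 2)) x).isOpen_image_of_subset_source hx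
    (singleton_subset_iff.2 (mem_chart_source _ x))
  rw [image_singleton] at this
  exact not_isOpen_singleton _ this

end TopAnosov

theorem mainTheorem8 {S : Type*} [MetricSpace S] [ChartedSpace (EuclideanSpace ℝ (Fin 2)) S]
    [NoncompactSpace S] (f : S ≃ₜ S) (hf : TopAnosov.IsTA f) :
    (∃ L : Set S, TopAnosov.IsBasicSet f L ∧
      (TopAnosov.IsAttracting f L ∨ TopAnosov.IsRepelling f L)) ∧
    ¬ ∀ L : Set S, TopAnosov.IsBasicSet f L → TopAnosov.IsSaddle f L := by
  have : LocallyCompactSpace S := ChartedSpace.locallyCompactSpace (EuclideanSpace ℝ (Fin 2)) S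
  have : Nonempty S := by
    by_contra h
    rw [not_nonempty_iff] at h
    exact NoncompactSpace.noncompact_univ (X := S) (by simp [univ_eq_empty_iff.2 h])
  obtain ⟨L, hL, h⟩ := hf.isDiagTA.exists_isBasicSet
    TopAnosov.singleton_notMem_nhds_of_chartedSpace
  exact ⟨⟨L, hL, h⟩, fun hall => hL.not_isSaddle h (hall L hL)⟩
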